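/- There is an absolute constant $C>0$ such that for every $n\ge 2$ and all vertex classes $L,R$ with $|L|=|R|=n$ there is a deterministic adaptive query algorithm (a decision tree) that solves the maximum-cardinality bipartite matching problem ($\mathsf{BMM}$) with at most $C\,n\log^2 n$ bipartite independent-set queries. That is, the input is an unknown bipartite graph $G=(L\cup R,E)$, $E\subseteq L\times R$, accessible only through queries; each query specifies sets $X\subseteq L$ and $Y\subseteq R$, chosen depending on the previous answers, and asks whether $G$ has an edge between a vertex of $X$ and a vertex of $Y$; and on every such $G$ the algorithm asks at most $C\,n\log^2 n$ queries and then outputs the edge set of a matching of $G$ of maximum cardinality. -/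

import Mathlib

/-- A deterministic algorithm with bipartite independent-set query access to a graph with vertex
classes `L` and `R`, i.e. an adaptive decision tree: it either stops with an output, or asks the
query `(X, Y)`, where `X ⊆ L` and `Y ⊆ R`, and continues according to the answer. -/
inductive ISAlgorithm (L R O : Type*) where
  | output (o : O) : ISAlgorithm L R O
  | query (X : Finset L) (Y : Finset R) (ifYes ifNo : ISAlgorithm L R O) : ISAlgorithm L R O

/-- The answer to the query `(X, Y)` on the graph `G`: is there an edge between `X` and `Y`? -/
def ISAnswer {L R : Type*} (G : SimpleGraph (L ⊕ R)) (X : Finset L) (Y : Finset R) : Prop :=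
  ∃ x ∈ X, ∃ y ∈ Y, G.Adj (Sum.inl x) (Sum.inr y)

namespace ISAlgorithm

open Classical in
/-- The output of the algorithm on the input graph `G`. -/
noncomputable def run {L R O : Type*} (G : SimpleGraph (L ⊕ R)) : ISAlgorithm L R O → O
  | output o => o
  | query X Y ifYes ifNo => if ISAnswer G X Y then run G ifYes else run G ifNo

open Classical in
/-- The number of queries that the algorithm asks on the input graph `G`. -/
noncomputable def numQueries {L R O : Type*} (G : SimpleGraph (L ⊕ R)) : ISAlgorithm L R O → ℕ
  | output _ => 0
  | query X Y ifYes ifNo =>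
      (if ISAnswer G X Y then numQueries G ifYes else numQueries G ifNo) + 1

end ISAlgorithm

/-- `M` is the edge set of a matching of `G`. -/
def IsMatchingEdges {V : Type*} (G : SimpleGraph V) (M : Finset (Sym2 V)) : Prop :=
  ∃ H : G.Subgraph, H.IsMatching ∧ H.edgeSet = (M : Set (Sym2 V))

/-- `M` is the edge set of a matching of `G` of maximum cardinality. -/
def IsMaximumMatching {V : Type*} (G : SimpleGraph V) (M : Finset (Sym2 V)) : Prop :=
  IsMatchingEdges G M ∧ ∀ M' : Finset (Sym2 V), IsMatchingEdges G M' → M'.card ≤ M.card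

/-- The algorithm solves maximum-cardinality bipartite matching on the vertex classes `L`, `R`:
on every bipartite graph with these classes it outputs a maximum matching. -/
def SolvesBMM {L R : Type*} (A : ISAlgorithm L R (Finset (Sym2 (L ⊕ R)))) : Prop :=
  ∀ G : SimpleGraph (L ⊕ R), G ≤ completeBipartiteGraph L R → IsMaximumMatching G (A.run G)

/-! ### Inscribed ellipsoids of largest volume, and how a central cut shrinks them. -/

section InscribedEllipsoid

open Matrix

variable {ι : Type*} [Fintype ι]

/-! A matching and a vertex cover of the same size certify each other. The algorithm keeps a set `F`
of known edges and a number k such that G has a vertex cover with at most k vertices; it stops as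
soon as `F` contains a matching of k edges.

Until then, the polytope of fractional covers of `F` of size at most k - 1/2 contains a ball of
radius 1/(8d), where d = 2n. Let c be the centre of an inscribed ellipsoid of largest volume. The
pairs with c u + c v ≥ 1 contain no matching of size k, because c has total weight below k, so by
Kőnig they have a cover (S, T) with fewer than k vertices (`exists_cover_of_isInscribed`). One query
asks for an edge avoiding S and T. If there is none, (S, T) covers G and k drops. Otherwise binary
search finds an edge with c u + c v < 1, whose constraint excludes c.

Such a cut lowers the largest squared volume, measured by `det`, by a factor 9/8
(`IsInscribed.det_le_of_cut`): otherwise the convex hull of the old and new ellipsoids would contain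
one larger than the old (`exists_hull_ellipsoid`). The determinant starts at most d! and stays at
least (8d)^(-2d) until the algorithm stops, so there are O(n log n) rounds of O(log n) queries each.
-/

theorem Matrix.PosSemidef.exists_mul_self_eq {A : Matrix ι ι ℝ} (hA : A.PosSemidef) :
    ∃ B : Matrix ι ι ℝ, B.PosSemidef ∧ B * B = A := by
  classical
  open scoped MatrixOrder in
  exact ⟨CFC.sqrt A, (CFC.sqrt_nonneg A).posSemidef, CFC.sqrt_mul_sqrt_self A hA.nonneg⟩

theorem Matrix.IsHermitian.dotProduct_mulVec_comm {A : Matrix ι ι ℝ} (hA : A.IsHermitian)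
    (x y : ι → ℝ) : x ⬝ᵥ A *ᵥ y = y ⬝ᵥ A *ᵥ x := by
  rw [dotProduct_mulVec, ← mulVec_transpose, dotProduct_comm]
  congr 2

theorem Matrix.PosSemidef.dotProduct_mulVec_nonneg' {A : Matrix ι ι ℝ} (hA : A.PosSemidef)
    (x : ι → ℝ) : 0 ≤ x ⬝ᵥ A *ᵥ x := by
  simpa using hA.dotProduct_mulVec_nonneg x

/-- The Cauchy-Schwarz inequality for a positive semidefinite form. -/
theorem Matrix.PosSemidef.dotProduct_mulVec_sq_le {A : Matrix ι ι ℝ} (hA : A.PosSemidef)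
    (x y : ι → ℝ) : (x ⬝ᵥ A *ᵥ y) ^ 2 ≤ (x ⬝ᵥ A *ᵥ x) * (y ⬝ᵥ A *ᵥ y) := by
  have h : ∀ t : ℝ, 0 ≤ (x ⬝ᵥ A *ᵥ x) * (t * t) + (2 * (x ⬝ᵥ A *ᵥ y)) * t + (y ⬝ᵥ A *ᵥ y) := by
    intro t
    have := hA.dotProduct_mulVec_nonneg' (t • x + y)
    simp only [mulVec_add, mulVec_smul, dotProduct_add, add_dotProduct, dotProduct_smul,
      smul_dotProduct, smul_eq_mul] at this
    rw [hA.isHermitian.dotProduct_mulVec_comm y x] at this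
    linarith
  have := discrim_le_zero h
  rw [discrim] at this
  linarith

theorem dotProduct_sq_le (x y : ι → ℝ) : (x ⬝ᵥ y) ^ 2 ≤ (x ⬝ᵥ x) * (y ⬝ᵥ y) := by
  classical
  simpa using (PosSemidef.one (n := ι) (R := ℝ)).dotProduct_mulVec_sq_le x y

variable [DecidableEq ι]

/-- A rank-one update increases the determinant at least as much as is seen in one direction. -/
theorem Matrix.PosDef.det_mul_le_det_add_vecMulVec {B : Matrix ι ι ℝ} (hB : B.PosDef)
    (u v : ι → ℝ) :
    B.det * (u ⬝ᵥ B *ᵥ u + (u ⬝ᵥ v) ^ 2) ≤ (B + vecMulVec v v).det * (u ⬝ᵥ B *ᵥ u) := by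
  have hu : IsUnit B.det := (Matrix.isUnit_iff_isUnit_det B).1 hB.isUnit
  have hdet : (B + vecMulVec v v).det = B.det * (1 + v ⬝ᵥ B⁻¹ *ᵥ v) := by
    rw [vecMulVec_eq Unit, det_add_replicateCol_mul_replicateRow hu, Matrix.mul_assoc, det_unique (n := Unit)]
    congr 2
  have hv : B *ᵥ (B⁻¹ *ᵥ v) = v := by
    rw [mulVec_mulVec, mul_nonsing_inv _ hu, one_mulVec]
  have hcs := hB.posSemidef.dotProduct_mulVec_sq_le u (B⁻¹ *ᵥ v)
  rw [hv, dotProduct_comm (B⁻¹ *ᵥ v) v] at hcs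
  rw [hdet]
  have := hB.det_pos
  nlinarith

/-- The left side is the larger root of x (x - m) = p q, while x = max p (m + q) satisfies x ≥ p and
x - m ≥ q. -/
theorem half_add_sqrt_le_max {p q m : ℝ} (hp : 0 ≤ p) (hq : 0 ≤ q) :
    m / 2 + √(p * q + m ^ 2 / 4) ≤ max p (m + q) := by
  rcases le_total m (p - q) with h | h
  · refine le_max_of_le_left ?_
    have : √(p * q + m ^ 2 / 4) ≤ p - m / 2 :=
      Real.sqrt_le_iff.2 ⟨by linarith, by nlinarith⟩
    linarith
  · refine le_max_of_le_right ?_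
    have : √(p * q + m ^ 2 / 4) ≤ q + m / 2 :=
      Real.sqrt_le_iff.2 ⟨by linarith, by nlinarith⟩
    linarith

/-- If the ellipsoid `d + B 𝔹` lies on the far side of a hyperplane through the centre of the unit
ball `𝔹`, then the convex hull of both contains an ellipsoid whose volume exceeds the geometric mean
of their volumes by a constant factor. -/
theorem exists_hull_ellipsoid_unit {B : Matrix ι ι ℝ} (hB : B.PosDef) {d u : ι → ℝ}
    (hu : u ⬝ᵥ u = 1) (hcut : (B *ᵥ u) ⬝ᵥ (B *ᵥ u) ≤ (u ⬝ᵥ d) ^ 2) :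
    ∃ v : ι → ℝ, 17 / 16 * B.det ≤ (B + vecMulVec v v).det ∧
      ∀ φ : ι → ℝ, (φ ⬝ᵥ d) / 2 + √(φ ⬝ᵥ B *ᵥ φ + (φ ⬝ᵥ v) ^ 2) ≤
        max √(φ ⬝ᵥ φ) (φ ⬝ᵥ d + √((B *ᵥ φ) ⬝ᵥ (B *ᵥ φ))) := by
  set s := u ⬝ᵥ B *ᵥ u with hs
  have hu0 : u ≠ 0 := by rintro rfl; simp at hu
  have hspos : 0 < s := by simpa using hB.dotProduct_mulVec_pos hu0
  have hdet := hB.det_pos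
  -- In both cases (u ⬝ᵥ v)² ≥ s / 16, which gives the factor 17/16. If s ≥ 1/4, the cut yields |u
  -- ⬝ᵥ d| ≥ |B u| ≥ s, so v = d / 2 works. If s ≤ 1/4, the ellipsoid is so thin along u that v = (u
  -- - B u) / 2 works without the cut.
  rcases le_total (1 / 4) s with h | h
  · refine ⟨(1 / 2 : ℝ) • d, ?_, fun φ ↦ ?_⟩
    · have h1 := hB.det_mul_le_det_add_vecMulVec u ((1 / 2 : ℝ) • d)
      rw [dotProduct_smul, smul_eq_mul, ← hs] at h1
      have h2 := dotProduct_sq_le u (B *ᵥ u)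
      rw [hu, ← hs] at h2
      have h3 : s * (17 / 16) ≤ s + (1 / 2 * u ⬝ᵥ d) ^ 2 := by nlinarith
      have h4 := (mul_le_mul_of_nonneg_left h3 hdet.le).trans h1
      exact le_of_mul_le_mul_right (by linarith) hspos
    · have hcs := dotProduct_sq_le φ (B *ᵥ φ)
      have h1 : φ ⬝ᵥ B *ᵥ φ ≤ √(φ ⬝ᵥ φ) * √((B *ᵥ φ) ⬝ᵥ (B *ᵥ φ)) := by
        rw [← Real.sqrt_mul (by simpa using dotProduct_star_self_nonneg φ)]
        exact Real.le_sqrt_of_sq_le hcs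
      refine le_trans ?_ (half_add_sqrt_le_max (Real.sqrt_nonneg _) (Real.sqrt_nonneg _))
      rw [dotProduct_smul, smul_eq_mul]
      gcongr
      nlinarith
  · refine ⟨(1 / 2 : ℝ) • (u - B *ᵥ u), ?_, fun φ ↦ ?_⟩
    · have h1 := hB.det_mul_le_det_add_vecMulVec u ((1 / 2 : ℝ) • (u - B *ᵥ u))
      rw [dotProduct_smul, smul_eq_mul, dotProduct_sub, hu, ← hs] at h1
      have h3 : s * (17 / 16) ≤ s + (1 / 2 * (1 - s)) ^ 2 := by nlinarith
      have h4 := (mul_le_mul_of_nonneg_left h3 hdet.le).trans h1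
      exact le_of_mul_le_mul_right (by linarith) hspos
    · set p := √(φ ⬝ᵥ φ) with hp
      set q := √((B *ᵥ φ) ⬝ᵥ (B *ᵥ φ)) with hq
      have hp2 : p ^ 2 = φ ⬝ᵥ φ := Real.sq_sqrt (by simpa using dotProduct_star_self_nonneg φ)
      have hq2 : q ^ 2 = (B *ᵥ φ) ⬝ᵥ (B *ᵥ φ) :=
        Real.sq_sqrt (by simpa using dotProduct_star_self_nonneg (B *ᵥ φ))
      have hpn : 0 ≤ p := Real.sqrt_nonneg _
      have hqn : 0 ≤ q := Real.sqrt_nonneg _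
      have hcs := dotProduct_sq_le φ (B *ᵥ φ)
      have h1 : φ ⬝ᵥ B *ᵥ φ ≤ p * q := by
        refine le_of_sq_le_sq ?_ (by positivity)
        rw [mul_pow, hp2, hq2]
        exact hcs
      have h2 := dotProduct_sq_le u (φ - B *ᵥ φ)
      have h3 : (φ - B *ᵥ φ) ⬝ᵥ (φ - B *ᵥ φ) = p ^ 2 - 2 * (φ ⬝ᵥ B *ᵥ φ) + q ^ 2 := by
        rw [hp2, hq2]
        simp only [sub_dotProduct, dotProduct_sub]
        rw [dotProduct_comm (B *ᵥ φ) φ]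
        ring
      have h4 : u ⬝ᵥ (φ - B *ᵥ φ) = φ ⬝ᵥ (u - B *ᵥ u) := by
        rw [dotProduct_sub, dotProduct_sub, dotProduct_comm φ u,
          hB.isHermitian.dotProduct_mulVec_comm u φ]
      rw [hu, h3, h4] at h2
      -- By `h2` and `h3` the radicand is at most (p² + q²) / 4 + (φ ⬝ᵥ B *ᵥ φ) / 2, and `h1`
      -- completes the square. The claim then bounds a maximum below by the mean of its two entries.
      have h5 : √(φ ⬝ᵥ B *ᵥ φ + (φ ⬝ᵥ (1 / 2 : ℝ) • (u - B *ᵥ u)) ^ 2) ≤ (p + q) / 2 := by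
        refine Real.sqrt_le_iff.2 ⟨by positivity, ?_⟩
        rw [dotProduct_smul, smul_eq_mul]
        nlinarith
      have h6 := le_max_left p (φ ⬝ᵥ d + q)
      have h7 := le_max_right p (φ ⬝ᵥ d + q)
      linarith

/-- The ellipsoid with centre `c` and support function `θ ↦ θ ⬝ᵥ c + √(θ ⬝ᵥ A *ᵥ θ)` satisfies all
the linear inequalities `θ ⬝ᵥ x ≤ b` for `(θ, b) ∈ K`. -/
def IsInscribed (K : Set ((ι → ℝ) × ℝ)) (c : ι → ℝ) (A : Matrix ι ι ℝ) : Prop :=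
  A.PosSemidef ∧ ∀ p ∈ K, p.1 ⬝ᵥ c + √(p.1 ⬝ᵥ A *ᵥ p.1) ≤ p.2

/-- The substitution by P = √A₁ turns the first ellipsoid into the unit ball and the second into one
with B² = P⁻¹ A₂ P⁻¹. The hypothesis `hcut` says that the hyperplane through c₁ with normal w does
not meet the interior of the second ellipsoid. -/
theorem exists_hull_ellipsoid {A₁ A₂ : Matrix ι ι ℝ} (h₁ : A₁.PosDef) (h₂ : A₂.PosDef)
    {c₁ c₂ w : ι → ℝ} (hw : w ≠ 0) (hcut : √(w ⬝ᵥ A₂ *ᵥ w) ≤ |w ⬝ᵥ (c₂ - c₁)|) :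
    ∃ A : Matrix ι ι ℝ, A.PosSemidef ∧ 9 / 8 * (A₁.det * A₂.det) ≤ A.det ^ 2 ∧
      ∀ θ : ι → ℝ, θ ⬝ᵥ ((1 / 2 : ℝ) • (c₁ + c₂)) + √(θ ⬝ᵥ A *ᵥ θ) ≤
        max (θ ⬝ᵥ c₁ + √(θ ⬝ᵥ A₁ *ᵥ θ)) (θ ⬝ᵥ c₂ + √(θ ⬝ᵥ A₂ *ᵥ θ)) := by
  obtain ⟨P, hP, hPA⟩ := h₁.posSemidef.exists_mul_self_eq
  have hPdet : P.det ≠ 0 := by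
    intro h
    have := h₁.det_pos
    rw [← hPA, det_mul, h] at this
    simp at this
  have hPu : IsUnit P.det := isUnit_iff_ne_zero.2 hPdet
  have hQT : (P⁻¹)ᴴ = P⁻¹ := hP.inv.isHermitian
  obtain ⟨B, hB, hBA⟩ := (h₂.posSemidef.mul_mul_conjTranspose_same P⁻¹).exists_mul_self_eq
  rw [hQT] at hBA
  have hA₂ : P * (B * B) * P = A₂ := by
    rw [hBA, Matrix.mul_assoc, Matrix.mul_assoc, nonsing_inv_mul _ hPu, Matrix.mul_one,
      mul_nonsing_inv_cancel_left _ _ hPu]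
  have hBdet : B.det ≠ 0 := by
    intro h
    have := h₂.det_pos
    rw [← hA₂, det_mul, det_mul, det_mul, h] at this
    simp at this
  have hBp : B.PosDef := hB.posDef_iff_det_ne_zero.2 hBdet
  have hsw : ∀ x y : ι → ℝ, x ⬝ᵥ P *ᵥ y = (P *ᵥ x) ⬝ᵥ y := fun x y ↦ by
    rw [hP.isHermitian.dotProduct_mulVec_comm, dotProduct_comm]
  have hform₁ : ∀ θ : ι → ℝ, θ ⬝ᵥ A₁ *ᵥ θ = (P *ᵥ θ) ⬝ᵥ (P *ᵥ θ) := fun θ ↦ by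
    rw [← hPA, ← mulVec_mulVec, hsw]
  have hform₂ : ∀ θ : ι → ℝ, θ ⬝ᵥ A₂ *ᵥ θ = (B *ᵥ (P *ᵥ θ)) ⬝ᵥ (B *ᵥ (P *ᵥ θ)) := fun θ ↦ by
    rw [← hA₂, ← mulVec_mulVec, ← mulVec_mulVec, ← mulVec_mulVec, hsw,
      hB.isHermitian.dotProduct_mulVec_comm, dotProduct_comm,
      ← hB.isHermitian.dotProduct_mulVec_comm, dotProduct_comm]
  set d : ι → ℝ := P⁻¹ *ᵥ (c₂ - c₁) with hd
  have hdot : ∀ θ : ι → ℝ, (P *ᵥ θ) ⬝ᵥ d = θ ⬝ᵥ (c₂ - c₁) := fun θ ↦ by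
    rw [← hsw, hd, mulVec_mulVec, mul_nonsing_inv _ hPu, one_mulVec]
  set u₀ : ι → ℝ := P *ᵥ w with hu₀
  have hN : 0 < u₀ ⬝ᵥ u₀ := by
    rw [← hform₁]
    simpa using h₁.dotProduct_mulVec_pos hw
  set r := (√(u₀ ⬝ᵥ u₀))⁻¹ with hr
  have hr2 : r * r * (u₀ ⬝ᵥ u₀) = 1 := by
    rw [hr, ← mul_inv, Real.mul_self_sqrt hN.le, inv_mul_cancel₀ hN.ne']
  have hu : (r • u₀) ⬝ᵥ (r • u₀) = 1 := by
    rw [smul_dotProduct, dotProduct_smul, smul_eq_mul, smul_eq_mul, ← mul_assoc, hr2]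
  have hcut' : (B *ᵥ (r • u₀)) ⬝ᵥ (B *ᵥ (r • u₀)) ≤ ((r • u₀) ⬝ᵥ d) ^ 2 := by
    rw [mulVec_smul, smul_dotProduct, dotProduct_smul, smul_dotProduct, hdot, smul_eq_mul,
      smul_eq_mul, smul_eq_mul, ← hform₂, mul_pow, ← mul_assoc, ← sq]
    refine mul_le_mul_of_nonneg_left ?_ (sq_nonneg r)
    have := (Real.sqrt_le_iff.1 hcut).2
    rwa [sq_abs] at this
  obtain ⟨v, hv, hsup⟩ := exists_hull_ellipsoid_unit hBp hu hcut'
  have hvv : (vecMulVec v v).PosSemidef := by simpa using posSemidef_vecMulVec_self_star v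
  refine ⟨P * (B + vecMulVec v v) * P, ?_, ?_, fun θ ↦ ?_⟩
  · have := (hB.add hvv).mul_mul_conjTranspose_same P
    rwa [hP.isHermitian.eq] at this
  · have e : 9 / 8 * (A₁.det * A₂.det) = P.det ^ 2 * P.det ^ 2 * (9 / 8 * B.det ^ 2) := by
      rw [← hPA, ← hA₂]
      simp only [det_mul]
      ring
    have e' : (P * (B + vecMulVec v v) * P).det ^ 2 =
        P.det ^ 2 * P.det ^ 2 * (B + vecMulVec v v).det ^ 2 := by
      simp only [det_mul]
      ring
    rw [e, e']
    refine mul_le_mul_of_nonneg_left ?_ (by positivity)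
    have := hBp.det_pos
    nlinarith
  · have h := hsup (P *ᵥ θ)
    have e : θ ⬝ᵥ (P * (B + vecMulVec v v) * P) *ᵥ θ =
        (P *ᵥ θ) ⬝ᵥ B *ᵥ (P *ᵥ θ) + ((P *ᵥ θ) ⬝ᵥ v) ^ 2 := by
      rw [← mulVec_mulVec, ← mulVec_mulVec, hsw, add_mulVec, dotProduct_add, vecMulVec_mulVec,
        dotProduct_comm v]
      simp [sq]
    rw [← hform₁, ← hform₂, hdot, ← e, dotProduct_sub] at h
    have e2 : θ ⬝ᵥ ((1 / 2 : ℝ) • (c₁ + c₂)) = θ ⬝ᵥ c₁ + (θ ⬝ᵥ c₂ - θ ⬝ᵥ c₁) / 2 := by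
      rw [dotProduct_smul, dotProduct_add, smul_eq_mul]
      ring
    rw [e2, add_assoc]
    refine (add_le_add_right h (θ ⬝ᵥ c₁)).trans ?_
    rw [← max_add_add_left]
    apply max_le_max le_rfl
    linarith

/-- Adding a linear inequality that cuts through the centre of an inscribed ellipsoid of largest
volume lowers the squared volume of the inscribed ellipsoids by a constant factor. -/
theorem IsInscribed.det_le_of_cut {K : Set ((ι → ℝ) × ℝ)} {c₁ c₂ w : ι → ℝ} {b : ℝ}
    {A₁ A₂ : Matrix ι ι ℝ} (h₁ : IsInscribed K c₁ A₁)
    (hmax : ∀ c A, IsInscribed K c A → A.det ≤ A₁.det) (hw : w ≠ 0) (hcut : b ≤ w ⬝ᵥ c₁)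
    (h₂ : IsInscribed (insert (w, b) K) c₂ A₂) : 9 / 8 * A₂.det ≤ A₁.det := by
  have h₂' : IsInscribed K c₂ A₂ := ⟨h₂.1, fun p hp ↦ h₂.2 p (Set.mem_insert_of_mem _ hp)⟩
  rcases h₂.1.det_nonneg.eq_or_lt with h0 | hA₂
  · rw [← h0]
    simpa using h₁.1.det_nonneg
  have hA₁ : 0 < A₁.det := hA₂.trans_le (hmax _ _ h₂')
  have hb := h₂.2 (w, b) (Set.mem_insert _ _)
  obtain ⟨A, hA, hdet, hsup⟩ := exists_hull_ellipsoid (h₁.1.posDef_iff_det_ne_zero.2 hA₁.ne')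
    (h₂.1.posDef_iff_det_ne_zero.2 hA₂.ne') (c₁ := c₁) (c₂ := c₂) hw (by
      rw [dotProduct_sub, abs_sub_comm]
      exact le_trans (by simp only at hb; linarith) (le_abs_self _))
  have := hmax _ _ (show IsInscribed K _ A from
    ⟨hA, fun p hp ↦ (hsup p.1).trans (max_le (h₁.2 p hp) (h₂'.2 p hp))⟩)
  -- The hull ellipsoid satisfies K, so 9/8 · det A₁ · det A₂ ≤ (det A)² ≤ (det A₁)², and det A₁
  -- cancels.
  have h := hdet.trans (pow_le_pow_left₀ hA.det_nonneg this 2)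
  exact le_of_mul_le_mul_left (by linarith) hA₁

theorem IsInscribed.center_mem_Icc {K : Set ((ι → ℝ) × ℝ)} {c : ι → ℝ} {A : Matrix ι ι ℝ}
    (h : IsInscribed K c A) (hub : ∀ i, (Pi.single i 1, 1) ∈ K)
    (hlb : ∀ i, (-Pi.single i 1, 0) ∈ K) (i : ι) : 0 ≤ c i ∧ c i ≤ 1 := by
  have h1 := h.2 _ (hub i)
  have h2 := h.2 _ (hlb i)
  simp only [neg_dotProduct, single_dotProduct, one_mul] at h1 h2
  have h3 := Real.sqrt_nonneg ((Pi.single i 1 : ι → ℝ) ⬝ᵥ A *ᵥ Pi.single i 1)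
  have h4 := Real.sqrt_nonneg (-Pi.single i (1 : ℝ) ⬝ᵥ A *ᵥ -Pi.single i 1)
  simp only [neg_dotProduct, single_dotProduct, one_mul] at h3 h4
  exact ⟨by linarith, by linarith⟩

/-- The cube bounds the diagonal and Cauchy-Schwarz the remaining entries. This gives both
compactness and the initial volume bound. -/
theorem IsInscribed.abs_apply_le_one {K : Set ((ι → ℝ) × ℝ)} {c : ι → ℝ} {A : Matrix ι ι ℝ}
    (h : IsInscribed K c A) (hub : ∀ i, (Pi.single i 1, 1) ∈ K)
    (hlb : ∀ i, (-Pi.single i 1, 0) ∈ K) (i j : ι) : |A i j| ≤ 1 := by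
  have hd : ∀ i, 0 ≤ A i i ∧ A i i ≤ 1 := fun i ↦ by
    refine ⟨h.1.diag_nonneg, ?_⟩
    have h1 := h.2 _ (hub i)
    simp only [single_dotProduct, one_mul, mulVec_single_one, col_apply] at h1
    have := (h.center_mem_Icc hub hlb i).1
    have := (Real.sqrt_le_iff.1 (show √(A i i) ≤ 1 by linarith)).2
    linarith
  have := h.1.dotProduct_mulVec_sq_le (Pi.single i 1) (Pi.single j 1)
  simp only [single_dotProduct, one_mul, mulVec_single_one, col_apply] at this
  rw [← sq_le_one_iff_abs_le_one]
  exact this.trans (mul_le_one₀ (hd i).2 (hd j).1 (hd j).2)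

omit [DecidableEq ι] in
theorem isClosed_setOf_isInscribed (K : Set ((ι → ℝ) × ℝ)) :
    IsClosed {x : (ι → ℝ) × (ι → ι → ℝ) | IsInscribed K x.1 (Matrix.of x.2)} := by
  have hq : ∀ y z : ι → ℝ,
      Continuous fun x : (ι → ℝ) × (ι → ι → ℝ) ↦ y ⬝ᵥ Matrix.of x.2 *ᵥ z := fun y z ↦ by
    simp only [dotProduct, mulVec, of_apply]
    fun_prop
  have hl : ∀ y : ι → ℝ, Continuous fun x : (ι → ℝ) × (ι → ι → ℝ) ↦ y ⬝ᵥ x.1 := fun y ↦ by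
    simp only [dotProduct]
    fun_prop
  have e : {x : (ι → ℝ) × (ι → ι → ℝ) | IsInscribed K x.1 (Matrix.of x.2)} =
      (⋂ (i) (j), {x | x.2 i j = x.2 j i}) ∩
      (⋂ y : ι → ℝ, {x | 0 ≤ y ⬝ᵥ Matrix.of x.2 *ᵥ y}) ∩
      ⋂ p ∈ K, {x | p.1 ⬝ᵥ x.1 + √(p.1 ⬝ᵥ Matrix.of x.2 *ᵥ p.1) ≤ p.2} := by
    ext x
    simp only [IsInscribed, posSemidef_iff_dotProduct_mulVec, Set.mem_ofPred_eq, Set.mem_inter_iff,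
      Set.mem_iInter, IsHermitian, star_trivial]
    refine and_congr_left fun _ ↦ and_congr_left fun _ ↦ ?_
    rw [← Matrix.ext_iff]
    simp only [conjTranspose_apply, of_apply, star_trivial]
    exact ⟨fun h i j ↦ h j i, fun h i j ↦ h j i⟩
  rw [e]
  refine ((isClosed_iInter fun i ↦ isClosed_iInter fun j ↦ ?_).inter
    (isClosed_iInter fun y ↦ ?_)).inter (isClosed_biInter fun p _ ↦ ?_)
  · exact isClosed_eq (by fun_prop) (by fun_prop)
  · exact isClosed_le continuous_const (hq y y)
  · exact isClosed_le ((hl p.1).add (hq p.1 p.1).sqrt) continuous_const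

/-- A polytope contained in the unit cube has an inscribed ellipsoid of largest volume. -/
theorem exists_isInscribed_det_max {K : Set ((ι → ℝ) × ℝ)}
    (hub : ∀ i, (Pi.single i 1, 1) ∈ K) (hlb : ∀ i, (-Pi.single i 1, 0) ∈ K)
    (hne : ∃ c A, IsInscribed K c A) :
    ∃ c A, IsInscribed K c A ∧ ∀ c' A', IsInscribed K c' A' → A'.det ≤ A.det := by
  have hcomp : IsCompact {x : (ι → ℝ) × (ι → ι → ℝ) | IsInscribed K x.1 (Matrix.of x.2)} := by
    refine IsCompact.of_isClosed_subset (isCompact_Icc (a := ((0, fun _ _ ↦ -1) :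
      (ι → ℝ) × (ι → ι → ℝ))) (b := (1, fun _ _ ↦ 1))) (isClosed_setOf_isInscribed K) ?_
    intro x hx
    have h1 := fun i ↦ IsInscribed.center_mem_Icc hx hub hlb i
    have h2 := fun i j ↦ abs_le.1 (IsInscribed.abs_apply_le_one hx hub hlb i j)
    exact ⟨⟨fun i ↦ (h1 i).1, fun i j ↦ (h2 i j).1⟩, ⟨fun i ↦ (h1 i).2, fun i j ↦ (h2 i j).2⟩⟩
  obtain ⟨c, A, hA⟩ := hne
  have hcont : Continuous fun x : (ι → ℝ) × (ι → ι → ℝ) ↦ (Matrix.of x.2).det := by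
    simp only [det_apply, of_apply]
    fun_prop
  obtain ⟨x, hx, hmax⟩ := hcomp.exists_isMaxOn ⟨(c, A), hA⟩ hcont.continuousOn
  exact ⟨x.1, Matrix.of x.2, hx, fun c' A' h' ↦ hmax (a := (c', A')) h'⟩

/-- The Leibniz expansion is crude, but only the logarithm of the bound matters, and it is O(d log
d). -/
theorem IsInscribed.det_le_factorial {K : Set ((ι → ℝ) × ℝ)} {c : ι → ℝ} {A : Matrix ι ι ℝ}
    (h : IsInscribed K c A) (hub : ∀ i, (Pi.single i 1, 1) ∈ K)
    (hlb : ∀ i, (-Pi.single i 1, 0) ∈ K) : A.det ≤ (Fintype.card ι).factorial := by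
  have := Matrix.det_le (abv := AbsoluteValue.abs) (h.abs_apply_le_one hub hlb)
  simp only [one_pow, nsmul_eq_mul, mul_one] at this
  exact (le_abs_self _).trans this

end InscribedEllipsoid

/-! ### Kőnig duality between matchings and vertex covers. -/

section Matching

variable {L R : Type*} [Fintype L] [Fintype R]

/-- The **Kőnig theorem**: a bipartite graph has a vertex cover with fewer than `k` vertices or a
matching with at least `k` edges. -/
theorem exists_cover_or_matching (r : L → R → Prop) (k : ℕ) :
    (∃ (S : Finset L) (T : Finset R), S.card + T.card < k ∧ ∀ u v, r u v → u ∈ S ∨ v ∈ T) ∨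
    ∃ M : Finset (L × R), k ≤ M.card ∧ (∀ p ∈ M, r p.1 p.2) ∧
      Set.InjOn Prod.fst (M : Set (L × R)) ∧ Set.InjOn Prod.snd (M : Set (L × R)) := by
  classical
  by_contra! h
  obtain ⟨h₁, h₂⟩ := h
  have hk : ∀ (S : Finset L) (T : Finset R), (∀ u v, r u v → u ∈ S ∨ v ∈ T) →
      k ≤ S.card + T.card := by
    intro S T hST
    by_contra! hlt
    obtain ⟨u, v, huv, hu, hv⟩ := h₁ S T hlt
    exact (hST u v huv).elim hu hv
  have hkL : k ≤ Fintype.card L := by simpa using hk Finset.univ ∅ (by simp)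
  -- Adding |L| - k dummy vertices adjacent to all of L reduces the deficiency version to Hall's
  -- theorem; at most |L| - k left vertices are then matched to dummies.
  let t : L → Finset (R ⊕ Fin (Fintype.card L - k)) := fun u ↦
    (Finset.univ.filter (r u)).disjSum Finset.univ
  have hall : ∀ S : Finset L, S.card ≤ (S.biUnion t).card := by
    intro S
    rcases S.eq_empty_or_nonempty with rfl | ⟨x, hx⟩
    · simp
    have hsub : (S.biUnion fun u ↦ Finset.univ.filter (r u)).disjSum
        (Finset.univ : Finset (Fin (Fintype.card L - k))) ⊆ S.biUnion t := by
      intro z hz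
      rcases z with z | z
      · simpa [t] using hz
      · simpa [t] using ⟨x, hx⟩
    have h1 := Finset.card_le_card hsub
    rw [Finset.card_disjSum, Finset.card_univ, Fintype.card_fin] at h1
    -- The complement of S together with the neighbours of S is a vertex cover.
    have h2 := hk Sᶜ (S.biUnion fun u ↦ Finset.univ.filter (r u)) (by
      intro u v huv
      by_cases hu : u ∈ S
      · exact Or.inr (by simpa using ⟨u, hu, huv⟩)
      · exact Or.inl (by simpa using hu))
    rw [Finset.card_compl] at h2
    have := S.card_le_univ
    omega
  obtain ⟨f, hf, hft⟩ := (Finset.all_card_le_biUnion_card_iff_exists_injective t).1 hall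
  let M : Finset (L × R) := Finset.univ.filter fun p ↦ f p.1 = Sum.inl p.2
  have hM : ∀ p, p ∈ M ↔ f p.1 = Sum.inl p.2 := fun p ↦ by simp [M]
  have hfst : Set.InjOn Prod.fst (M : Set (L × R)) := by
    rintro ⟨u, v⟩ hp ⟨u', v'⟩ hq (rfl : u = u')
    have h1 := (hM _).1 hp
    have h2 := (hM _).1 hq
    simp only [h1, Sum.inl.injEq] at h2
    rw [h2]
  obtain ⟨p, hp, q, hq, hpq, hne⟩ : ∃ p ∈ M, ∃ q ∈ M, p.2 = q.2 ∧ p ≠ q := by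
    by_contra! hinj
    refine h₂ M ?_ ?_ hfst fun p hp q hq hpq ↦ hinj p hp q hq hpq
    · have h1 : (M.image Prod.fst)ᶜ.card ≤ Fintype.card L - k := by
        have : ((M.image Prod.fst)ᶜ.image f) ⊆ Finset.univ.image Sum.inr := by
          intro z hz
          obtain ⟨u, hu, rfl⟩ := Finset.mem_image.1 hz
          rcases hfu : f u with v | i
          · exact absurd (Finset.mem_image_of_mem Prod.fst ((hM (u, v)).2 hfu))
              (Finset.mem_compl.1 hu)
          · simp
        have h2 := Finset.card_le_card this
        rw [Finset.card_image_of_injective _ hf, Finset.card_image_of_injective _ Sum.inr_injective,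
          Finset.card_univ, Fintype.card_fin] at h2
        exact h2
      rw [Finset.card_compl, Finset.card_image_of_injOn hfst] at h1
      omega
    · intro p hp
      have h1 := hft p.1
      rw [(hM p).1 hp] at h1
      simpa [t] using h1
  have h1 := (hM p).1 hp
  rw [hpq, ← (hM q).1 hq] at h1
  exact hne (Prod.ext (hf h1) hpq)

omit [Fintype L] [Fintype R] in
open Classical in
/-- A matching at least as large as a vertex cover is a maximum matching. -/
theorem isMaximumMatching_of_card_cover_le {G : SimpleGraph (L ⊕ R)}
    (hG : G ≤ completeBipartiteGraph L R) {S : Finset L} {T : Finset R}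
    (hcov : ∀ u v, G.Adj (Sum.inl u) (Sum.inr v) → u ∈ S ∨ v ∈ T) {M : Finset (L × R)}
    (hM : ∀ p ∈ M, G.Adj (Sum.inl p.1) (Sum.inr p.2))
    (hfst : Set.InjOn Prod.fst (M : Set (L × R))) (hsnd : Set.InjOn Prod.snd (M : Set (L × R)))
    (hcard : S.card + T.card ≤ M.card) :
    IsMaximumMatching G (M.image fun p ↦ s(Sum.inl p.1, Sum.inr p.2)) := by
  have hcardM : (M.image fun p ↦ s((Sum.inl p.1 : L ⊕ R), Sum.inr p.2)).card = M.card := by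
    refine Finset.card_image_of_injective _ fun p q h ↦ ?_
    simpa [Prod.ext_iff] using h
  refine ⟨⟨⟨{x | ∃ p ∈ M, x = Sum.inl p.1 ∨ x = Sum.inr p.2},
    fun x y ↦ ∃ p ∈ M, s(x, y) = s(Sum.inl p.1, Sum.inr p.2), ?_, ?_, ?_⟩, ?_, ?_⟩, ?_⟩
  · rintro x y ⟨p, hp, h⟩
    rw [← SimpleGraph.mem_edgeSet, h]
    exact hM p hp
  · rintro x y ⟨p, hp, h⟩
    refine ⟨p, hp, ?_⟩
    rcases Sym2.eq_iff.1 h with h | h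
    · exact Or.inl h.1
    · exact Or.inr h.1
  · refine ⟨?_⟩
    rintro x y ⟨p, hp, h⟩
    exact ⟨p, hp, by rw [Sym2.eq_swap, h]⟩
  · rintro x ⟨p, hp, rfl | rfl⟩
    · refine ⟨Sum.inr p.2, ⟨p, hp, rfl⟩, ?_⟩
      rintro y ⟨q, hq, h⟩
      rcases Sym2.eq_iff.1 h with h | h
      · rw [h.2, hfst hp hq (Sum.inl_injective h.1)]
      · exact absurd h.1 (by simp)
    · refine ⟨Sum.inl p.1, ⟨p, hp, Sym2.eq_swap⟩, ?_⟩
      rintro y ⟨q, hq, h⟩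
      rcases Sym2.eq_iff.1 h with h | h
      · exact absurd h.1 (by simp)
      · rw [h.2, hsnd hp hq (Sum.inr_injective h.1)]
  · ext e
    induction e with
    | h x y => simp [eq_comm]
  · rintro M' ⟨H, hH, hE⟩
    rw [hcardM]
    refine le_trans ?_ hcard
    rw [← Finset.card_disjSum]
    have hex : ∀ e ∈ M', ∃ x ∈ S.disjSum T, x ∈ e := by
      intro e he
      have he' : e ∈ H.edgeSet := by rw [hE]; exact he
      induction e with
      | h x y =>
        have hadj := H.adj_sub he'
        have hb := hG hadj
        rcases x with x | x <;> rcases y with y | y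
        · simp at hb
        · rcases hcov x y hadj with h | h
          · exact ⟨Sum.inl x, by simpa using h, by simp⟩
          · exact ⟨Sum.inr y, by simpa using h, by simp⟩
        · rcases hcov y x hadj.symm with h | h
          · exact ⟨Sum.inl y, by simpa using h, by simp⟩
          · exact ⟨Sum.inr x, by simpa using h, by simp⟩
        · simp at hb
    -- Every edge of a matching contains a cover vertex, and no vertex lies in two of its edges.
    refine Finset.card_le_card_of_forall_subsingleton (fun e x ↦ x ∈ e) hex ?_
    rintro x - e ⟨he, y, rfl⟩ e' ⟨he', y', rfl⟩
    have h1 : s(x, y) ∈ H.edgeSet := by rw [hE]; exact he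
    have h2 : s(x, y') ∈ H.edgeSet := by rw [hE]; exact he'
    exact congrArg _ (hH.eq_of_adj_left h1 h2)

end Matching

/-! ### The polytope of fractional vertex covers. -/

section CoverPolytope

open Matrix

variable {L R : Type*} [Fintype L] [Fintype R] [DecidableEq L] [DecidableEq R]

/-- The negated incidence vector of a pair of vertices. -/
def pairNormal (e : L × R) : L ⊕ R → ℝ :=
  -(Pi.single (Sum.inl e.1) 1 + Pi.single (Sum.inr e.2) 1)

/-- The linear inequalities describing the fractional vertex covers of `F` of size at most
`k - 1 / 2`. -/
def coverPolytope (F : Finset (L × R)) (k : ℕ) : Set ((L ⊕ R → ℝ) × ℝ) :=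
  {p | (∃ i, p = (Pi.single i 1, 1)) ∨ (∃ i, p = (-Pi.single i 1, 0)) ∨
    (∃ e ∈ F, p = (pairNormal e, -1)) ∨ p = (1, (k : ℝ) - 1 / 2)}

omit [Fintype L] [Fintype R] in
theorem coverPolytope_insert (e : L × R) (F : Finset (L × R)) (k : ℕ) :
    coverPolytope (insert e F) k = insert (pairNormal e, -1) (coverPolytope F k) := by
  ext p
  simp only [coverPolytope, Finset.mem_insert, exists_eq_or_imp, Set.mem_insert_iff,
    Set.mem_ofPred_eq, or_assoc, or_left_comm]

omit [Fintype L] [Fintype R] in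
theorem single_mem_coverPolytope (F : Finset (L × R)) (k : ℕ) (i : L ⊕ R) :
    (Pi.single i 1, 1) ∈ coverPolytope F k := Or.inl ⟨i, rfl⟩

omit [Fintype L] [Fintype R] in
theorem neg_single_mem_coverPolytope (F : Finset (L × R)) (k : ℕ) (i : L ⊕ R) :
    (-Pi.single i 1, 0) ∈ coverPolytope F k := Or.inr (Or.inl ⟨i, rfl⟩)

theorem pairNormal_dotProduct (e : L × R) (c : L ⊕ R → ℝ) :
    pairNormal e ⬝ᵥ c = -(c (Sum.inl e.1) + c (Sum.inr e.2)) := by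
  simp [pairNormal, add_dotProduct]

omit [Fintype L] [Fintype R] in
theorem pairNormal_ne_zero (e : L × R) : pairNormal e ≠ 0 := by
  intro h
  have := congrFun h (Sum.inl e.1)
  simp [pairNormal] at this

theorem IsInscribed.mono_card {F : Finset (L × R)} {k k' : ℕ} (hk : k' ≤ k) {c : L ⊕ R → ℝ}
    {A : Matrix (L ⊕ R) (L ⊕ R) ℝ} (h : IsInscribed (coverPolytope F k') c A) :
    IsInscribed (coverPolytope F k) c A := by
  refine ⟨h.1, fun p hp ↦ ?_⟩
  rcases hp with hp | hp | hp | rfl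
  · exact h.2 p (Or.inl hp)
  · exact h.2 p (Or.inr (Or.inl hp))
  · exact h.2 p (Or.inr (Or.inr (Or.inl hp)))
  · refine (h.2 _ (Or.inr (Or.inr (Or.inr rfl)))).trans ?_
    have : (k' : ℝ) ≤ k := by exact_mod_cast hk
    simpa using this

/-- A vertex cover with fewer than `k` vertices yields a large inscribed ball. -/
theorem exists_isInscribed_of_cover [Nonempty (L ⊕ R)] {F : Finset (L × R)} {k : ℕ} {S : Finset L}
    {T : Finset R} (hcard : S.card + T.card < k) (hcov : ∀ e ∈ F, e.1 ∈ S ∨ e.2 ∈ T) :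
    ∃ c A, IsInscribed (coverPolytope F k) c A ∧
      ((8 * Fintype.card (L ⊕ R) : ℝ)⁻¹ ^ 2) ^ Fintype.card (L ⊕ R) = A.det := by
  set d : ℝ := (Fintype.card (L ⊕ R) : ℝ) with hd
  have hd1 : 1 ≤ d := by
    rw [hd]
    exact_mod_cast Fintype.card_pos (α := L ⊕ R)
  set ρ : ℝ := (8 * d)⁻¹ with hρ
  have hρ0 : 0 < ρ := by positivity
  have hρd : ρ * d = 1 / 8 := by rw [hρ]; field_simp
  have hρ8 : ρ ≤ 1 / 8 := by nlinarith
  -- The indicator of the cover, pushed inwards. Each covered pair has weight at least 1 + 2ρ, and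
  -- its normal has length √2 ≤ 2. In the size constraint the shift and the radius cost at most 3ρd
  -- + ρd = 1/2, which fits between k - 1 and k - 1/2.
  let c : L ⊕ R → ℝ := fun i ↦ if i ∈ S.disjSum T then 1 - ρ else 3 * ρ
  have hlo : ∀ i, 3 * ρ ≤ c i := fun i ↦ by
    simp only [c]
    split_ifs <;> linarith
  have hhi : ∀ i, c i ≤ 1 - ρ := fun i ↦ by
    simp only [c]
    split_ifs <;> linarith
  have hform : ∀ (θ : L ⊕ R → ℝ) (x : ℝ), 0 ≤ x → θ ⬝ᵥ θ ≤ x ^ 2 →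
      √(θ ⬝ᵥ (ρ ^ 2 • (1 : Matrix (L ⊕ R) (L ⊕ R) ℝ)) *ᵥ θ) ≤ ρ * x := by
    intro θ x hx hθ
    rw [smul_mulVec, one_mulVec, dotProduct_smul, smul_eq_mul]
    refine Real.sqrt_le_iff.2 ⟨by positivity, ?_⟩
    rw [mul_pow]
    gcongr
  refine ⟨c, ρ ^ 2 • 1, ⟨PosSemidef.one.smul (by positivity), ?_⟩, by simp⟩
  rintro p (⟨i, rfl⟩ | ⟨i, rfl⟩ | ⟨e, he, rfl⟩ | rfl)
  · have := hform (Pi.single i 1) 1 zero_le_one (by simp)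
    have := hhi i
    simp only [single_dotProduct, one_mul] at *
    linarith
  · have := hform (-Pi.single i 1) 1 zero_le_one (by simp)
    have := hlo i
    simp only [neg_dotProduct, single_dotProduct, one_mul] at *
    linarith
  · have h1 := hform (pairNormal e) 2 zero_le_two (by
      rw [pairNormal_dotProduct]
      simp [pairNormal]
      norm_num)
    have h2 : 1 - ρ + 3 * ρ ≤ c (Sum.inl e.1) + c (Sum.inr e.2) := by
      rcases hcov e he with h | h
      · have h3 : c (Sum.inl e.1) = 1 - ρ := if_pos (by simpa using h)
        have := hlo (Sum.inr e.2)
        linarith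
      · have h3 : c (Sum.inr e.2) = 1 - ρ := if_pos (by simpa using h)
        have := hlo (Sum.inl e.1)
        linarith
    simp only [pairNormal_dotProduct e c]
    linarith
  · have h1 := hform 1 d (by positivity) (by
      simp only [dotProduct_one, Pi.one_apply, Finset.sum_const, Finset.card_univ, nsmul_eq_mul,
        mul_one, ← hd]
      nlinarith)
    have h2 : (1 : L ⊕ R → ℝ) ⬝ᵥ c ≤ (S.card + T.card : ℕ) + 3 * ρ * d := by
      rw [one_dotProduct]
      calc ∑ i, c i ≤ ∑ i, ((if i ∈ S.disjSum T then 1 else 0) + 3 * ρ) := by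
            refine Finset.sum_le_sum fun i _ ↦ ?_
            simp only [c]
            split_ifs <;> linarith
        _ = _ := by
            rw [Finset.sum_add_distrib, Finset.sum_boole, Finset.filter_univ_mem,
              Finset.card_disjSum, Finset.sum_const, Finset.card_univ, nsmul_eq_mul, ← hd]
            ring
    have h3 : ((S.card + T.card : ℕ) : ℝ) + 1 ≤ k := by exact_mod_cast hcard
    simp only
    linarith

/-- A fractional vertex cover rounds to a vertex cover of the pairs that it covers. -/
theorem exists_cover_of_isInscribed {F : Finset (L × R)} {k : ℕ} {c : L ⊕ R → ℝ}
    {A : Matrix (L ⊕ R) (L ⊕ R) ℝ} (h : IsInscribed (coverPolytope F k) c A) :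
    ∃ (S : Finset L) (T : Finset R), S.card + T.card < k ∧
      ∀ u ∉ S, ∀ v ∉ T, c (Sum.inl u) + c (Sum.inr v) < 1 := by
  rcases exists_cover_or_matching (fun u v ↦ 1 ≤ c (Sum.inl u) + c (Sum.inr v)) k with
    ⟨S, T, hcard, hcov⟩ | ⟨M, hcard, hM, hfst, hsnd⟩
  · refine ⟨S, T, hcard, fun u hu v hv ↦ ?_⟩
    by_contra! hlt
    exact (hcov u v hlt).elim hu hv
  -- Disjoint pairs of weight at least 1, k of them, would force total weight k > k - 1/2.
  · exfalso
    have hc := fun i ↦ (h.center_mem_Icc (single_mem_coverPolytope F k)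
      (neg_single_mem_coverPolytope F k) i).1
    have h1 := h.2 (1, (k : ℝ) - 1 / 2) (Or.inr (Or.inr (Or.inr rfl)))
    have h2 := Real.sqrt_nonneg ((1 : L ⊕ R → ℝ) ⬝ᵥ A *ᵥ 1)
    simp only [one_dotProduct, Fintype.sum_sum_type] at h1 h2
    have h3 : (M.card : ℝ) ≤ ∑ p ∈ M, (c (Sum.inl p.1) + c (Sum.inr p.2)) := by
      simpa using Finset.card_nsmul_le_sum M _ 1 hM
    have h4 : ∑ p ∈ M, c (Sum.inl p.1) ≤ ∑ u, c (Sum.inl u) := by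
      rw [← Finset.sum_image (f := fun u ↦ c (Sum.inl u)) hfst]
      exact Finset.sum_le_sum_of_subset_of_nonneg (Finset.subset_univ _) fun i _ _ ↦ hc _
    have h5 : ∑ p ∈ M, c (Sum.inr p.2) ≤ ∑ v, c (Sum.inr v) := by
      rw [← Finset.sum_image (f := fun v ↦ c (Sum.inr v)) hsnd]
      exact Finset.sum_le_sum_of_subset_of_nonneg (Finset.subset_univ _) fun i _ _ ↦ hc _
    rw [Finset.sum_add_distrib] at h3
    have h6 : (k : ℝ) ≤ M.card := by exact_mod_cast hcard
    linarith

end CoverPolytope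

/-! ### The query algorithm and its round count. -/

section Algorithm

variable {L R : Type*}

theorem isAnswer_union_left [DecidableEq L] {G : SimpleGraph (L ⊕ R)} {X X' : Finset L}
    {Y : Finset R} : ISAnswer G (X ∪ X') Y ↔ ISAnswer G X Y ∨ ISAnswer G X' Y := by
  simp only [ISAnswer, Finset.mem_union, or_and_right, exists_or]

theorem isAnswer_union_right [DecidableEq R] {G : SimpleGraph (L ⊕ R)} {X : Finset L}
    {Y Y' : Finset R} : ISAnswer G X (Y ∪ Y') ↔ ISAnswer G X Y ∨ ISAnswer G X Y' := by
  simp only [ISAnswer, Finset.mem_union, or_and_right, exists_or, and_or_left]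

theorem Finset.exists_union_eq_card_le {α : Type*} [DecidableEq α] {s : Finset α} {m : ℕ}
    (h : s.card ≤ 2 ^ (m + 1)) :
    ∃ t t' : Finset α, t ∪ t' = s ∧ t.card ≤ 2 ^ m ∧ t'.card ≤ 2 ^ m := by
  rcases le_total s.card (2 ^ m) with hs | hs
  · exact ⟨s, ∅, by simp, hs, by simp⟩
  · obtain ⟨t, ht, hc⟩ := Finset.exists_subset_card_eq hs
    refine ⟨t, s \ t, Finset.union_sdiff_of_subset ht, hc.le, ?_⟩
    rw [Finset.card_sdiff_of_subset ht, hc]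
    omega

/-- Binary search for an edge between `X` and `Y`, after which the algorithm `K u v` for the edge
`(u, v)` that was found is run. -/
theorem exists_findEdge {O : Type*} [Nonempty O] (K : L → R → ISAlgorithm L R O) (a b : ℕ) :
    ∀ (X : Finset L) (Y : Finset R), X.card ≤ 2 ^ a → Y.card ≤ 2 ^ b →
    ∃ A : ISAlgorithm L R O, ∀ G : SimpleGraph (L ⊕ R), ISAnswer G X Y →
      ∃ u ∈ X, ∃ v ∈ Y, G.Adj (Sum.inl u) (Sum.inr v) ∧ A.run G = (K u v).run G ∧
        A.numQueries G ≤ a + b + (K u v).numQueries G := by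
  classical
  induction a with
  | zero =>
    induction b with
    | zero =>
      intro X Y hX hY
      by_cases hne : X.Nonempty ∧ Y.Nonempty
      · obtain ⟨⟨x, hx⟩, y, hy⟩ := hne
        refine ⟨K x y, fun G ⟨u, hu, v, hv, huv⟩ ↦ ⟨u, hu, v, hv, huv, ?_⟩⟩
        rw [Finset.card_le_one.1 hX u hu x hx, Finset.card_le_one.1 hY v hv y hy]
        simp
      -- Nothing is required when no edge is promised, so any output serves.
      · refine ⟨.output (Classical.arbitrary O), fun G ⟨u, hu, v, hv, _⟩ ↦ ?_⟩
        exact absurd ⟨⟨u, hu⟩, v, hv⟩ hne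
    | succ b ih =>
      intro X Y hX hY
      obtain ⟨Y₁, Y₂, rfl, h₁, h₂⟩ := Finset.exists_union_eq_card_le hY
      obtain ⟨A₁, hA₁⟩ := ih X Y₁ hX h₁
      obtain ⟨A₂, hA₂⟩ := ih X Y₂ hX h₂
      refine ⟨.query X Y₁ A₁ A₂, fun G hG ↦ ?_⟩
      by_cases h : ISAnswer G X Y₁
      · obtain ⟨u, hu, v, hv, huv, hr, hq⟩ := hA₁ G h
        refine ⟨u, hu, v, Finset.mem_union_left _ hv, huv, ?_⟩
        simp only [ISAlgorithm.run, ISAlgorithm.numQueries, if_pos h]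
        exact ⟨hr, by omega⟩
      -- A negative answer on one half already guarantees an edge in the other, so one query per
      -- halving suffices.
      · obtain ⟨u, hu, v, hv, huv, hr, hq⟩ := hA₂ G ((isAnswer_union_right.1 hG).resolve_left h)
        refine ⟨u, hu, v, Finset.mem_union_right _ hv, huv, ?_⟩
        simp only [ISAlgorithm.run, ISAlgorithm.numQueries, if_neg h]
        exact ⟨hr, by omega⟩
  | succ a ih =>
    intro X Y hX hY
    obtain ⟨X₁, X₂, rfl, h₁, h₂⟩ := Finset.exists_union_eq_card_le hX
    obtain ⟨A₁, hA₁⟩ := ih X₁ Y h₁ hY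
    obtain ⟨A₂, hA₂⟩ := ih X₂ Y h₂ hY
    refine ⟨.query X₁ Y A₁ A₂, fun G hG ↦ ?_⟩
    by_cases h : ISAnswer G X₁ Y
    · obtain ⟨u, hu, v, hv, huv, hr, hq⟩ := hA₁ G h
      refine ⟨u, Finset.mem_union_left _ hu, v, hv, huv, ?_⟩
      simp only [ISAlgorithm.run, ISAlgorithm.numQueries, if_pos h]
      exact ⟨hr, by omega⟩
    · obtain ⟨u, hu, v, hv, huv, hr, hq⟩ := hA₂ G ((isAnswer_union_left.1 hG).resolve_left h)
      refine ⟨u, Finset.mem_union_right _ hu, v, hv, huv, ?_⟩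
      simp only [ISAlgorithm.run, ISAlgorithm.numQueries, if_neg h]
      exact ⟨hr, by omega⟩

variable [Fintype L] [Fintype R] [DecidableEq L] [DecidableEq R]

/-- `A` finds a maximum matching, with at most `q` queries, in every bipartite graph that contains
the pairs `F` and has a vertex cover with at most `k` vertices. -/
def SolvesWithin (A : ISAlgorithm L R (Finset (Sym2 (L ⊕ R)))) (F : Finset (L × R)) (k q : ℕ) :
    Prop :=
  ∀ G : SimpleGraph (L ⊕ R), G ≤ completeBipartiteGraph L R →
    (∀ e ∈ F, G.Adj (Sum.inl e.1) (Sum.inr e.2)) →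
    (∃ (S : Finset L) (T : Finset R), S.card + T.card ≤ k ∧
      ∀ u v, G.Adj (Sum.inl u) (Sum.inr v) → u ∈ S ∨ v ∈ T) →
    IsMaximumMatching G (A.run G) ∧ A.numQueries G ≤ q

-- The stopping rule: k disjoint known edges meet the promised cover of size at most k, so no
-- further query is needed.
omit [Fintype L] [Fintype R] in
theorem exists_solvesWithin_of_matching {F M : Finset (L × R)} {k : ℕ} (hk : k ≤ M.card)
    (hM : ∀ p ∈ M, p ∈ F) (hfst : Set.InjOn Prod.fst (M : Set (L × R)))
    (hsnd : Set.InjOn Prod.snd (M : Set (L × R))) (q : ℕ) :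
    ∃ A : ISAlgorithm L R (Finset (Sym2 (L ⊕ R))), SolvesWithin A F k q := by
  classical
  refine ⟨.output (M.image fun p ↦ s(Sum.inl p.1, Sum.inr p.2)), fun G hG hF hc ↦ ?_⟩
  obtain ⟨S, T, hST, hcov⟩ := hc
  refine ⟨?_, by simp [ISAlgorithm.numQueries]⟩
  simp only [ISAlgorithm.run]
  convert isMaximumMatching_of_card_cover_le hG hcov (fun p hp ↦ hF p (hM p hp)) hfst hsnd
    (hST.trans hk)

/-- The inscribed ellipsoid method: every round either improves the known vertex cover or finds an
edge that cuts through the centre of the current ellipsoid. -/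
theorem exists_solvesWithin [Nonempty (L ⊕ R)] {a : ℕ} (hL : Fintype.card L ≤ 2 ^ a)
    (hR : Fintype.card R ≤ 2 ^ a) (t : ℕ) :
    ∀ (k j : ℕ) (F : Finset (L × R)), k + j = t →
      (∀ c A, IsInscribed (coverPolytope F k) c A → A.det <
        ((8 * Fintype.card (L ⊕ R) : ℝ)⁻¹ ^ 2) ^ Fintype.card (L ⊕ R) * (9 / 8) ^ j) →
      ∃ A : ISAlgorithm L R (Finset (Sym2 (L ⊕ R))), SolvesWithin A F k (t * (2 * a + 1)) := by
  induction t with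
  | zero =>
    intro k j F hkj _
    obtain rfl : k = 0 := by omega
    exact exists_solvesWithin_of_matching (M := ∅) (by simp) (by simp) (by simp) (by simp) _
  | succ t ih =>
    intro k j F hkj hdet
    rcases exists_cover_or_matching (fun u v ↦ (u, v) ∈ F) k with
      ⟨S₀, T₀, hcard₀, hcov₀⟩ | ⟨M, hcard, hM, hfst, hsnd⟩
    swap
    · exact exists_solvesWithin_of_matching hcard hM hfst hsnd _
    obtain ⟨c₀, A₀, hA₀, hdet₀⟩ := exists_isInscribed_of_cover hcard₀ fun e he ↦ hcov₀ e.1 e.2 he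
    obtain ⟨c, E, hE, hmax⟩ := exists_isInscribed_det_max (single_mem_coverPolytope F k)
      (neg_single_mem_coverPolytope F k) ⟨c₀, A₀, hA₀⟩
    -- For j = 0 the inscribed ball would violate the strict volume bound, so some cut is still in
    -- the budget.
    obtain ⟨j, rfl⟩ : ∃ i, j = i + 1 := by
      refine Nat.exists_eq_succ_of_ne_zero ?_
      rintro rfl
      have := hdet c₀ A₀ hA₀
      rw [hdet₀] at this
      simp at this
    obtain ⟨S, T, hcard, hST⟩ := exists_cover_of_isInscribed hE
    -- A negative answer lowers k and leaves the volume budget untouched: j + 1 is its value before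
    -- the renaming.
    obtain ⟨Ano, hAno⟩ := ih (k - 1) (j + 1) F (by omega) fun c A h ↦
      hdet c A (h.mono_card (Nat.sub_le k 1))
    have hyes : ∀ u v, ∃ A : ISAlgorithm L R (Finset (Sym2 (L ⊕ R))),
        u ∉ S → v ∉ T → SolvesWithin A (insert (u, v) F) k (t * (2 * a + 1)) := by
      intro u v
      by_cases huv : u ∉ S ∧ v ∉ T
      · obtain ⟨A, hA⟩ := ih k j (insert (u, v) F) (by omega) fun c' A h ↦ by
          rw [coverPolytope_insert] at h
          have h1 := hE.det_le_of_cut hmax (pairNormal_ne_zero (u, v)) (by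
            rw [pairNormal_dotProduct]
            have := hST u huv.1 v huv.2
            simp only
            linarith) h
          have h2 := hdet c E hE
          rw [pow_succ (9 / 8 : ℝ)] at h2
          linarith
        exact ⟨A, fun _ _ ↦ hA⟩
      -- Pairs meeting S or T are never returned by the search.
      · exact ⟨.output ∅, fun hu hv ↦ absurd ⟨hu, hv⟩ huv⟩
    choose K hK using hyes
    obtain ⟨Ayes, hAyes⟩ := exists_findEdge K a a Sᶜ Tᶜ ((Finset.card_le_univ _).trans hL)
      ((Finset.card_le_univ _).trans hR)
    refine ⟨.query Sᶜ Tᶜ Ayes Ano, fun G hG hF hc ↦ ?_⟩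
    by_cases hans : ISAnswer G Sᶜ Tᶜ
    · simp only [ISAlgorithm.run, ISAlgorithm.numQueries, if_pos hans]
      obtain ⟨u, hu, v, hv, huv, hrun, hq⟩ := hAyes G hans
      obtain ⟨h1, h2⟩ := hK u v (by simpa using hu) (by simpa using hv) G hG (by
        intro e he
        rcases Finset.mem_insert.1 he with rfl | he
        · exact huv
        · exact hF e he) hc
      rw [hrun]
      refine ⟨h1, ?_⟩
      rw [add_mul]
      omega
    · simp only [ISAlgorithm.run, ISAlgorithm.numQueries, if_neg hans]
      obtain ⟨h1, h2⟩ := hAno G hG hF ⟨S, T, by omega, fun u v huv ↦ by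
        by_contra! hcon
        exact hans ⟨u, by simpa using hcon.1, v, by simpa using hcon.2, huv⟩⟩
      refine ⟨h1, ?_⟩
      rw [add_mul]
      omega

/-- With d = 2n, d! < (8d)^d, so it suffices that (8d)^(3d) ≤ (9/8)^(240an). This follows from 8d ≤
2^(5a) and 2 ≤ (9/8)^8, as 240 = 8 · 5 · 6. -/
theorem factorial_lt_mul_pow {n a : ℕ} (hn : 1 ≤ n) (ha : 1 ≤ a) (hna : n ≤ 2 ^ a) :
    ((2 * n).factorial : ℝ) <
      ((8 * (2 * n : ℕ) : ℝ)⁻¹ ^ 2) ^ (2 * n) * (9 / 8) ^ (240 * a * n) := by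
  have h1 : ((2 * n).factorial : ℝ) ≤ (2 * n : ℕ) ^ (2 * n) := by
    exact_mod_cast Nat.factorial_le_pow _
  have h2 : (8 * (2 * n : ℕ) : ℝ) ^ (6 * n) ≤ (9 / 8) ^ (240 * a * n) := by
    have h3 : (2 : ℝ) ≤ (9 / 8) ^ 8 := by norm_num
    have h4 : (8 * (2 * n : ℕ) : ℝ) ≤ 2 ^ (5 * a) := by
      have : 8 * (2 * n) ≤ 2 ^ (5 * a) := by
        calc 8 * (2 * n) = 2 ^ 4 * n := by ring
          _ ≤ 2 ^ (4 * a) * 2 ^ a := Nat.mul_le_mul (Nat.pow_le_pow_right (by norm_num) (by omega)) hna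
          _ = 2 ^ (5 * a) := by rw [← pow_add]; congr 1; ring
      exact_mod_cast this
    calc (8 * (2 * n : ℕ) : ℝ) ^ (6 * n) ≤ (2 ^ (5 * a)) ^ (6 * n) := by gcongr
      _ ≤ (((9 / 8) ^ 8) ^ (5 * a)) ^ (6 * n) := by gcongr
      _ = (9 / 8) ^ (240 * a * n) := by
        rw [← pow_mul, ← pow_mul]
        congr 1
        ring
  set x : ℝ := ((2 * n : ℕ) : ℝ) with hx
  have hx0 : 0 < x := by rw [hx]; exact_mod_cast (by omega : 0 < 2 * n)
  calc ((2 * n).factorial : ℝ) ≤ x ^ (2 * n) := h1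
    _ < (8 * x) ^ (2 * n) := pow_lt_pow_left₀ (by linarith) hx0.le (by omega)
    _ = ((8 * x)⁻¹ ^ 2) ^ (2 * n) * (8 * x) ^ (6 * n) := by
      rw [show 6 * n = 2 * (2 * n) + 2 * n by ring, pow_add, pow_mul (8 * x) 2 (2 * n), ← mul_assoc,
        ← mul_pow, ← mul_pow (8 * x)⁻¹, inv_mul_cancel₀ (by positivity), one_pow, one_pow, one_mul]
    _ ≤ _ := by gcongr

theorem clog_two_le_mul_log {n : ℕ} (hn : 2 ≤ n) : (Nat.clog 2 n : ℝ) ≤ 4 * Real.log n := by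
  have hn' : (2 : ℝ) ≤ n := by exact_mod_cast hn
  have h1 : 2 ^ (Nat.clog 2 n).pred < n := Nat.pow_pred_clog_lt_self (by norm_num) (by omega)
  have h2 : ((Nat.clog 2 n).pred : ℝ) * Real.log 2 ≤ Real.log n := by
    rw [← Real.log_pow]
    exact Real.log_le_log (by positivity) (by exact_mod_cast h1.le)
  have h3 : Real.log 2 ≤ Real.log n := Real.log_le_log (by norm_num) hn'
  have h4 := Real.log_two_gt_d9
  have h5 : (Nat.clog 2 n : ℝ) ≤ (Nat.clog 2 n).pred + 1 := by
    exact_mod_cast Nat.le_succ_of_pred_le le_rfl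
  have h6 : (0 : ℝ) ≤ (Nat.clog 2 n).pred := Nat.cast_nonneg _
  nlinarith

end Algorithm

theorem mainTheorem6 :
    ∃ C : ℝ, 0 < C ∧ ∀ n : ℕ, 2 ≤ n →
      ∀ (L : Type*) (R : Type*) [Fintype L] [Fintype R],
        Fintype.card L = n → Fintype.card R = n →
        ∃ A : ISAlgorithm L R (Finset (Sym2 (L ⊕ R))),
          SolvesBMM A ∧
          ∀ G : SimpleGraph (L ⊕ R), G ≤ completeBipartiteGraph L R →
            (A.numQueries G : ℝ) ≤ C * (n * Real.log n ^ 2) := by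
  -- Here 723 = 241 · 3 comes from (n + 240an)(2a + 1) with 1 ≤ a, and 16 from a ≤ 4 log n.
  -- Initially k = n, since L is a vertex cover.
  refine ⟨723 * 16, by norm_num, fun n hn L R _ _ hL hR ↦ ?_⟩
  classical
  set a := Nat.clog 2 n with ha
  have ha1 : 1 ≤ a := Nat.clog_pos (by norm_num) hn
  have hna : n ≤ 2 ^ a := Nat.le_pow_clog (by norm_num) n
  have hcard : Fintype.card (L ⊕ R) = 2 * n := by rw [Fintype.card_sum, hL, hR]; ring
  have : Nonempty (L ⊕ R) := Fintype.card_pos_iff.1 (by omega)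
  obtain ⟨A, hA⟩ := exists_solvesWithin (hL.trans_le hna) (hR.trans_le hna) _ n (240 * a * n) ∅ rfl
    fun c E hE ↦ (hE.det_le_factorial (single_mem_coverPolytope ∅ n)
      (neg_single_mem_coverPolytope ∅ n)).trans_lt (by
        rw [hcard]
        exact factorial_lt_mul_pow (by omega) ha1 hna)
  have hcov : ∀ G : SimpleGraph (L ⊕ R), ∃ (S : Finset L) (T : Finset R), S.card + T.card ≤ n ∧
      ∀ u v, G.Adj (Sum.inl u) (Sum.inr v) → u ∈ S ∨ v ∈ T := fun G ↦
    ⟨Finset.univ, ∅, by simp [hL], by simp⟩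
  refine ⟨A, fun G hG ↦ (hA G hG (by simp) (hcov G)).1, fun G hG ↦ ?_⟩
  have hq := (hA G hG (by simp) (hcov G)).2
  have h1 : A.numQueries G ≤ 723 * (n * a ^ 2) := by
    refine hq.trans ?_
    calc (n + 240 * a * n) * (2 * a + 1) ≤ (a * n + 240 * a * n) * (2 * a + a) := by
          gcongr
          exact Nat.le_mul_of_pos_left n ha1
      _ = 723 * (n * a ^ 2) := by ring
  have h2 := clog_two_le_mul_log hn
  calc (A.numQueries G : ℝ) ≤ 723 * (n * (a : ℝ) ^ 2) := by exact_mod_cast h1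
    _ ≤ 723 * (n * (4 * Real.log n) ^ 2) := by gcongr
    _ = 723 * 16 * (n * Real.log n ^ 2) := by ring
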